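/- Let $\mathcal H$ be a finite-dimensional complex Hilbert space, let $\mathfrak H(\mathcal H)$ be the real vector space of self-adjoint operators on $\mathcal H$, and let $\mathfrak S$ be the set of density operators on $\mathcal H$ ($\rho\ge 0$, $\operatorname{tr}\rho=1$). Let $(\rho^{(n)})_{n\ge 1}$ be an exchangeable sequence of states: $\rho^{(n)}$ is a density operator on $\mathcal H^{\otimes n}$, it is invariant under all permutations of the $n$ tensor factors, and $\rho^{(n)}=\operatorname{tr}_{n+1}\rho^{(n+1)}$ for every $n\ge 1$. Let $k$ range over an arbitrary index set. For each $k$ let $V^k$ be a real vector space; let $Y$ be a measurable space with a reference measure $dy$; let $L^k_y:\mathfrak H(\mathcal H)\to V^k$ be a real-linear map for every $k$ and every $y\in Y$; and let $q^k:Y\to\mathbb R$ be densities with $q^k(y)>0$ for almost every $y$. Identify $\mathfrak H(\mathcal H\otimes\mathcal H)$ with $\mathfrak H(\mathcal H)\otimes_{\mathbb R}\mathfrak H(\mathcal H)$, and suppose that $$\int_Y dy\, q^k(y)\,\bigl(L^k_y\otimes L^k_y\bigr)\bigl(\rho^{(2)}\bigr)=0\in V^k\otimes_{\mathbb R} V^k\qquad\text{for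 all }k .$$ Here the vector-valued integral is meant in the weak sense: for every linear functional $\varphi$ on $V^k\otimes_{\mathbb R} V^k$ the function $y\mapsto q^k(y)\,\varphi\bigl((L^k_y\otimes L^k_y)(\rho^{(2)})\bigr)$ is integrable with integral zero. (For finite-dimensional $V^k$ this is the usual coordinatewise integral.) Then there is a unique Borel probability measure $P$ on $\mathfrak S$ such that $$\rho^{(n)}=\int_{\mathfrak S} \rho^{\otimes n}\,dP(\rho)\qquad\text{for all }n\ge 1,$$ and this $P$ is concentrated on the states satisfying the constraints at the single-trial level: for $P$-almost every $\rho$, for every $k$, one has $L^k_y(\rho)=0$ for almost every $y\in Y$. -/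

import Mathlib

open MeasureTheory
open scoped TensorProduct ComplexOrder

/-- The real vector space of self-adjoint operators on the finite-dimensional Hilbert space `ℂ^ι`,
as Hermitian matrices. -/
abbrev Herm (ι : Type*) [Fintype ι] [DecidableEq ι] : Type _ :=
  selfAdjoint (Matrix ι ι ℂ)

/-- Density operators (states) on `ℂ^ι`: positive semidefinite matrices of trace one. -/
def DensityMatrix (ι : Type*) [Fintype ι] [DecidableEq ι] : Type _ :=
  {A : Matrix ι ι ℂ // A.PosSemidef ∧ A.trace = 1}

namespace DensityMatrix

variable {ι : Type*} [Fintype ι] [DecidableEq ι]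

/-- The topology of the space of states: entrywise convergence. -/
instance : TopologicalSpace (DensityMatrix ι) :=
  inferInstanceAs (TopologicalSpace {A : Matrix ι ι ℂ // A.PosSemidef ∧ A.trace = 1})

/-- Measures on the space of states are Borel measures. -/
instance : MeasurableSpace (DensityMatrix ι) := borel _

instance : BorelSpace (DensityMatrix ι) := ⟨rfl⟩

/-- A state as a self-adjoint operator. -/
def toHerm (s : DensityMatrix ι) : Herm ι :=
  ⟨s.1, s.2.1.isHermitian⟩

end DensityMatrix

section Trials

/-! The `n`-trial space `(ℂ^d)^{⊗n}` is `ℂ^(Fin n → d)`: the product basis vector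
`|μ_1 … μ_n⟩` is indexed by the function `μ : Fin n → d`. -/

variable {d : Type*} [Fintype d] [DecidableEq d]

/-- The tensor power `A^{⊗n}`. -/
def tensorPow (n : ℕ) (A : Matrix d d ℂ) : Matrix (Fin n → d) (Fin n → d) ℂ :=
  Matrix.of fun i j => ∏ t, A (i t) (j t)

/-- `U(σ) = ∑_μ |μ_{σ(1)} … μ_{σ(n)}⟩⟨μ_1 … μ_n|`. -/
def permOp {n : ℕ} (σ : Equiv.Perm (Fin n)) : Matrix (Fin n → d) (Fin n → d) ℂ :=
  ∑ μ : Fin n → d, Matrix.single (μ ∘ σ) μ 1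

/-- The partial trace over the last of `n + 1` tensor factors. -/
def partialTraceLast {n : ℕ} (A : Matrix (Fin (n + 1) → d) (Fin (n + 1) → d) ℂ) :
    Matrix (Fin n → d) (Fin n → d) ℂ :=
  Matrix.of fun i j =>
    ∑ a : d, A (Fin.snoc (α := fun _ => d) i a) (Fin.snoc (α := fun _ => d) j a)

/-- An exchangeable sequence of states: each `ρ n` is invariant under permutations of the trials,
and `ρ n` is obtained from `ρ (n + 1)` by tracing out the last trial. (The member `ρ 0` is the
only state of the one-dimensional space, and the conditions for `n = 0` hold trivially.) -/
structure Exchangeable (ρ : (n : ℕ) → DensityMatrix (Fin n → d)) : Prop where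
  symmetric : ∀ (n : ℕ) (σ : Equiv.Perm (Fin n)),
    permOp σ * (ρ n).1 * (permOp σ).conjTranspose = (ρ n).1
  extendible : ∀ n : ℕ, (ρ n).1 = partialTraceLast (ρ (n + 1)).1

/-- The probability measure `P` on single-trial states represents the sequence:
`ρ n = ∫ s^{⊗n} dP(s)` for all `n`. The integral of the (bounded, continuous) matrix-valued
function is taken entry by entry. -/
def IsDeFinettiRepresentation (ρ : (n : ℕ) → DensityMatrix (Fin n → d))
    (P : ProbabilityMeasure (DensityMatrix d)) : Prop :=
  ∀ (n : ℕ) (i j : Fin n → d),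
    (ρ n).1 i j = ∫ s : DensityMatrix d, tensorPow n s.1 i j ∂(P : Measure (DensityMatrix d))

end Trials

section TwoTrials

/-! Self-adjoint operators on the two-trial space are the real tensor square of the single-trial
self-adjoint operators. -/

variable {d : Type*} [Fintype d] [DecidableEq d]

/-- The product operator `A ⊗ B` on the two-trial space. -/
def prodOp (A B : Matrix d d ℂ) : Matrix (Fin 2 → d) (Fin 2 → d) ℂ :=
  Matrix.of fun i j => A (i 0) (j 0) * B (i 1) (j 1)

/-- The map `A ⊗ B ↦ A ⊗ B` from the abstract real tensor product to two-trial operators. -/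
noncomputable def hermTensor : Herm d ⊗[ℝ] Herm d →ₗ[ℝ] Herm (Fin 2 → d) :=
  TensorProduct.lift <| LinearMap.mk₂ ℝ
    (fun A B => ⟨prodOp A.1 B.1, by
      have hA := A.2
      have hB := B.2
      rw [selfAdjoint.mem_iff] at hA hB ⊢
      ext i j
      have h1 := congrFun (congrFun hA (i 0)) (j 0)
      have h2 := congrFun (congrFun hB (i 1)) (j 1)
      simp only [Matrix.star_apply, prodOp, Matrix.of_apply, star_mul'] at h1 h2 ⊢
      rw [h1, h2]⟩)
    (fun A A' B => by ext i j; simp [prodOp, add_mul])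
    (fun c A B => by ext i j; simp [prodOp, mul_assoc])
    (fun A B B' => by ext i j; simp [prodOp, mul_add])
    (fun c A B => by ext i j; simp [prodOp, mul_left_comm])

theorem hermTensor_tmul (A B : Herm d) : (hermTensor (A ⊗ₜ[ℝ] B)).1 = prodOp A.1 B.1 := by
  simp [hermTensor]

instance finite_herm (ι : Type*) [Fintype ι] [DecidableEq ι] : Module.Finite ℝ (Herm ι) :=
  Module.Finite.of_surjective (realPart : Matrix ι ι ℂ →ₗ[ℝ] Herm ι)
    fun A => ⟨A.1, Subtype.ext A.2.coe_realPart⟩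

theorem finrank_herm (ι : Type*) [Fintype ι] [DecidableEq ι] :
    Module.finrank ℝ (Herm ι) = Fintype.card ι * Fintype.card ι := by
  have hb : Function.Bijective (skewAdjoint.negISMul (A := Matrix ι ι ℂ)) := by
    refine ⟨fun a b h => ?_, fun a => ⟨⟨Complex.I • a.1, ?_⟩, ?_⟩⟩
    · apply Subtype.ext
      rw [← skewAdjoint.I_smul_neg_I a, ← skewAdjoint.I_smul_neg_I b, h]
    · have := a.2
      rw [selfAdjoint.mem_iff] at this
      simp [skewAdjoint.mem_iff, this]
    · apply Subtype.ext
      simp [skewAdjoint.negISMul, smul_smul]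
  let e := LinearEquiv.ofBijective _ hb
  have : Module.Finite ℝ (skewAdjoint (Matrix ι ι ℂ)) := Module.Finite.equiv e.symm
  have e2 := (StarModule.decomposeProdAdjoint ℝ (Matrix ι ι ℂ)).finrank_eq
  rw [Module.finrank_prod, e.finrank_eq] at e2
  have e3 : Module.finrank ℝ (Matrix ι ι ℂ) = 2 * (Fintype.card ι * Fintype.card ι) := by
    rw [Module.finrank_matrix, Complex.finrank_real_complex, mul_comm]
  have e4 : Module.finrank ℝ (Herm ι) + Module.finrank ℝ (Herm ι) =
      2 * (Fintype.card ι * Fintype.card ι) := e2.symm.trans e3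
  omega

theorem realPart_prodOp (X Y : Matrix d d ℂ) :
    realPart (prodOp X Y) =
      hermTensor (realPart X ⊗ₜ[ℝ] realPart Y - imaginaryPart X ⊗ₜ[ℝ] imaginaryPart Y) := by
  apply Subtype.ext
  rw [map_sub, AddSubgroupClass.coe_sub, hermTensor_tmul, hermTensor_tmul]
  ext i j
  simp only [realPart_apply_coe, imaginaryPart_apply_coe, prodOp, Matrix.sub_apply,
    Matrix.smul_apply, Matrix.add_apply, Matrix.star_apply, Matrix.of_apply, star_mul',
    Complex.real_smul, smul_eq_mul]
  push_cast
  linear_combination (norm := ring_nf) (1 / 4 : ℂ) * (X (i 0) (j 0) - star (X (j 0) (i 0))) *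
    (Y (i 1) (j 1) - star (Y (j 1) (i 1))) * Complex.I_sq

theorem hermTensor_surjective : Function.Surjective (hermTensor (d := d)) := by
  rw [← LinearMap.range_eq_top, eq_top_iff]
  rintro A -
  have hA : realPart A.1 = A := A.2.coe_realPart |> Subtype.ext
  rw [← hA, Matrix.matrix_eq_sum_single A.1, map_sum]
  refine Submodule.sum_mem _ fun i _ => ?_
  rw [map_sum]
  refine Submodule.sum_mem _ fun j _ => ?_
  have h : Matrix.single i j (A.1 i j) =
      prodOp (Matrix.single (i 0) (j 0) (A.1 i j)) (Matrix.single (i 1) (j 1) 1) := by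
    ext k l
    simp only [prodOp, Matrix.of_apply, Matrix.single_apply, funext_iff, Fin.forall_fin_two]
    split_ifs <;> simp_all
  rw [h, realPart_prodOp]
  exact ⟨_, rfl⟩

theorem hermTensor_bijective : Function.Bijective (hermTensor (d := d)) := by
  have h : Module.finrank ℝ (Herm d ⊗[ℝ] Herm d) = Module.finrank ℝ (Herm (Fin 2 → d)) := by
    rw [Module.finrank_tensorProduct, finrank_herm, finrank_herm]
    simp
    ring
  exact ⟨(LinearMap.injective_iff_surjective_of_finrank_eq_finrank h).2 hermTensor_surjective,
    hermTensor_surjective⟩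

/-- The identification of the real tensor square of single-trial self-adjoint operators with
two-trial self-adjoint operators, sending `A ⊗ B` to `A ⊗ B`. -/
noncomputable def hermTensorEquiv : (Herm d ⊗[ℝ] Herm d) ≃ₗ[ℝ] Herm (Fin 2 → d) :=
  LinearEquiv.ofBijective hermTensor hermTensor_bijective

/-- The map `L ⊗ L` applied to a self-adjoint operator on the two-trial space. -/
noncomputable def tensorSq {V : Type*} [AddCommGroup V] [Module ℝ V] (L : Herm d →ₗ[ℝ] V) :
    Herm (Fin 2 → d) →ₗ[ℝ] V ⊗[ℝ] V :=
  (TensorProduct.map L L).comp hermTensorEquiv.symm.toLinearMap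

end TwoTrials

/-- `∫ f dμ = 0` for a function with values in a real vector space `W` without topology: for every
linear functional `φ` on `W`, the function `φ ∘ f` is integrable with integral zero. For
finite-dimensional `W` this is the usual (coordinatewise) integral. -/
def IntegralEqZero {Y W : Type*} [MeasurableSpace Y] [AddCommGroup W] [Module ℝ W]
    (μ : Measure Y) (f : Y → W) : Prop :=
  ∀ φ : W →ₗ[ℝ] ℝ, Integrable (fun y => φ (f y)) μ ∧ ∫ y, φ (f y) ∂μ = 0

/-! Existence is quantum tomography plus compactness. Fix a resolution of the identity by rank one
operators whose outcome weights determine a matrix linearly, through Hermitian matrices `D a`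
(`exists_tomography`). Measuring all `N` trials of `ρ N` gives random outcomes; the mean of the
corresponding `D a` is a random Hermitian matrix in a fixed compact box. Its moments of order `n`
tend to the entries of `ρ n`: terms with distinct trials give them exactly by exchangeability, and
repeated trials are asymptotically negligible (`Exchangeable.norm_moment_sub_le`). A limit point of
these laws therefore has exactly the required moments.

The moments force the limit measure to live on states. The trace has zero variance about 1, and for
`‖ψ‖ ≤ 1` the even moments of `tr s - ⟨ψ|s|ψ⟩` are at most 1, so `|1 - ⟨ψ|s|ψ⟩| ≤ 1` on the support.
Uniqueness is Stone–Weierstrass for polynomials in the entries.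

For the constraints, evaluate `(L ⊗ L)(ρ 2)` with a functional `φ` such that `φ (v ⊗ v)` is positive
definite. The value is the `P`-average of `φ (L s ⊗ L s) ≥ 0`; multiplied by `q > 0` it integrates
to zero over `y`, so it vanishes for almost every `y`, and then `L s = 0` for every `s` in the
support of `P`. -/

/-! ### Outcome weights of product measurements. -/

section Weights

variable {d A : Type*} [Fintype d]

/-- `⟨v_α|R|v_α⟩` for the product vector `v_α = v_{α_1} ⊗ … ⊗ v_{α_n}`. -/
def productWeight (v : A → d → ℂ) {n : ℕ} (R : Matrix (Fin n → d) (Fin n → d) ℂ)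
    (α : Fin n → A) : ℂ :=
  ∑ i, ∑ j, (∏ t, star (v (α t) (i t))) * R i j * ∏ t, v (α t) (j t)

/-- The rank one operators of the family `v` sum to the identity. -/
def IsResolution [Fintype A] [DecidableEq d] (v : A → d → ℂ) : Prop :=
  ∀ x y, ∑ a, star (v a x) * v a y = if x = y then 1 else 0

/-- The computation behind all moments. It is used with `g = 1` (total weight), with entries of `D`
(tomography) and with 0/1-valued `g` (positivity). -/
theorem sum_productWeight_mul_prod [Fintype A] (v : A → d → ℂ) {n : ℕ}
    (R : Matrix (Fin n → d) (Fin n → d) ℂ) (g : Fin n → A → ℂ) :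
    ∑ α, productWeight v R α * ∏ t, g t (α t) =
      ∑ i, ∑ j, R i j * ∏ t, ∑ a, star (v a (i t)) * v a (j t) * g t a := by
  classical
  simp only [productWeight, Finset.prod_univ_sum, Fintype.piFinset_univ, Finset.mul_sum,
    Finset.sum_mul]
  rw [Finset.sum_comm]
  refine Finset.sum_congr rfl fun i _ => ?_
  rw [Finset.sum_comm]
  refine Finset.sum_congr rfl fun j _ => Finset.sum_congr rfl fun α _ => ?_
  simp only [Finset.prod_mul_distrib]
  ring

theorem productWeight_nonneg (v : A → d → ℂ) {n : ℕ} {R : Matrix (Fin n → d) (Fin n → d) ℂ}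
    (hR : R.PosSemidef) (α : Fin n → A) : 0 ≤ productWeight v R α := by
  have h := hR.dotProduct_mulVec_nonneg (fun j : Fin n → d => ∏ t, v (α t) (j t))
  convert h using 1
  simp only [productWeight, dotProduct, Matrix.mulVec, Pi.star_apply, star_prod, Finset.mul_sum,
    mul_assoc]

theorem sum_productWeight [Fintype A] [DecidableEq d] {v : A → d → ℂ} (hv : IsResolution v) {n : ℕ}
    (R : Matrix (Fin n → d) (Fin n → d) ℂ) : ∑ α, productWeight v R α = R.trace := by
  have h := sum_productWeight_mul_prod v R (fun _ _ => 1)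
  simp only [Finset.prod_const_one, mul_one, hv _ _] at h
  rw [h, Matrix.trace]
  refine Finset.sum_congr rfl fun i _ => ?_
  rw [Finset.sum_eq_single i]
  · simp
  · intro j _ hj
    obtain ⟨t, ht⟩ := Function.ne_iff.1 hj
    rw [Finset.prod_eq_zero (Finset.mem_univ t), mul_zero]
    rw [if_neg (Ne.symm ht)]
  · simp

theorem sum_fin_succ_snoc {X M : Type*} [Fintype X] [AddCommMonoid M] {n : ℕ}
    (f : (Fin (n + 1) → X) → M) :
    ∑ i, f i = ∑ i : Fin n → X, ∑ x, f (Fin.snoc (α := fun _ => X) i x) := by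
  rw [← (Fin.snocEquiv (fun _ : Fin (n + 1) => X)).sum_comp, Fintype.sum_prod_type,
    Finset.sum_comm]
  rfl

/-- Summing over the last outcome puts the identity on the last factor, which is the partial trace.
-/
theorem sum_productWeight_snoc [Fintype A] [DecidableEq d] {v : A → d → ℂ} (hv : IsResolution v) {n : ℕ}
    (R : Matrix (Fin (n + 1) → d) (Fin (n + 1) → d) ℂ) (α : Fin n → A) :
    ∑ a, productWeight v R (Fin.snoc (α := fun _ => A) α a) =
      productWeight v (partialTraceLast R) α := by
  simp only [productWeight, sum_fin_succ_snoc (X := d), Fin.prod_univ_castSucc, Fin.snoc_castSucc,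
    Fin.snoc_last]
  rw [Finset.sum_comm]
  refine Finset.sum_congr rfl fun i _ => ?_
  simp only [Finset.sum_comm (s := (Finset.univ : Finset A))]
  rw [Finset.sum_comm]
  refine Finset.sum_congr rfl fun j _ => ?_
  have h : ∀ x y, ∑ a, (∏ t, star (v (α t) (i t))) * star (v a x) *
      R (Fin.snoc (α := fun _ => d) i x) (Fin.snoc (α := fun _ => d) j y) *
      ((∏ t, v (α t) (j t)) * v a y) =
      (∏ t, star (v (α t) (i t))) * R (Fin.snoc (α := fun _ => d) i x)
        (Fin.snoc (α := fun _ => d) j y) * (∏ t, v (α t) (j t)) * if x = y then 1 else 0 := by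
    intro x y
    rw [← hv x y, Finset.mul_sum]
    exact Finset.sum_congr rfl fun a _ => by ring
  simp only [h, partialTraceLast, Matrix.of_apply, Finset.mul_sum, Finset.sum_mul]
  simp

theorem permOp_apply [DecidableEq d] {n : ℕ} (σ : Equiv.Perm (Fin n)) (i j : Fin n → d) :
    permOp σ i j = if j ∘ σ = i then 1 else 0 := by
  simp only [permOp, Matrix.sum_apply, Matrix.single_apply]
  rw [Finset.sum_eq_single j] <;> simp +contextual

theorem apply_comp_perm_of_permOp [DecidableEq d] {n : ℕ} {R : Matrix (Fin n → d) (Fin n → d) ℂ}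
    (σ : Equiv.Perm (Fin n)) (h : permOp σ * R * (permOp σ).conjTranspose = R)
    (i j : Fin n → d) : R (i ∘ σ) (j ∘ σ) = R i j := by
  have hinj : ∀ k l : Fin n → d, k ∘ σ = l ∘ σ ↔ k = l := fun k l =>
    σ.surjective.injective_comp_right.eq_iff
  have h' := congrFun (congrFun h (i ∘ σ)) (j ∘ σ)
  rw [← h']
  simp [Matrix.mul_apply, permOp_apply, hinj]

theorem productWeight_comp_perm {n : ℕ} (v : A → d → ℂ) {R : Matrix (Fin n → d) (Fin n → d) ℂ}
    (σ : Equiv.Perm (Fin n)) (h : ∀ i j, R (i ∘ σ) (j ∘ σ) = R i j) (α : Fin n → A) :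
    productWeight v R (α ∘ σ) = productWeight v R α := by
  simp only [productWeight]
  rw [← (σ.arrowCongr (Equiv.refl d)).symm.sum_comp]
  refine Finset.sum_congr rfl fun i _ => ?_
  rw [← (σ.arrowCongr (Equiv.refl d)).symm.sum_comp]
  refine Finset.sum_congr rfl fun j _ => ?_
  have e : ∀ i : Fin n → d, (σ.arrowCongr (Equiv.refl d)).symm i = i ∘ σ := fun i => by
    ext; simp [Equiv.arrowCongr]
  rw [e, e, h]
  simp only [Function.comp]
  rw [Equiv.prod_comp σ (fun t => star (v (α t) (i t))),
    Equiv.prod_comp σ (fun t => v (α t) (j t))]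

end Weights

/-! ### An informationally complete measurement. -/

section Tomography

/-- Tomography of `ℂ^d`: a resolution of the identity by rank one operators `|v a⟩⟨v a|` whose
outcome frequencies determine the operator, through the self-adjoint matrices `D a`. -/
theorem exists_tomography (d : Type*) [Fintype d] [DecidableEq d] [Nonempty d] :
    ∃ (v : (d × d) × Fin 4 → d → ℂ) (D : (d × d) × Fin 4 → Matrix d d ℂ),
      IsResolution v ∧ (∀ a, (D a).IsHermitian) ∧
      ∀ x y k l, ∑ a, star (v a x) * v a y * D a k l = if k = x ∧ l = y then 1 else 0 := by
  -- The vectors are `c (e_a + i^m e_b)` with `m < 4`. Summing over `m` cancels the cross terms, and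
  -- the sum over `a, b` leaves `8 |d| c²` times the identity.
  set c : ℝ := 1 / Real.sqrt (8 * Fintype.card d)
  have hc : (c : ℂ) * c * (8 * Fintype.card d) = 1 := by
    norm_cast
    have : (0 : ℝ) < 8 * Fintype.card d := by positivity
    simp only [c]
    rw [div_mul_div_comm, Real.mul_self_sqrt this.le]
    push_cast
    field_simp
  obtain ⟨δ, hδ⟩ : ∃ δ : d → d → ℂ, ∀ x y, δ x y = if x = y then 1 else 0 :=
    ⟨_, fun _ _ => rfl⟩
  have hs : ∀ x y, (starRingEnd ℂ) (δ x y) = δ x y := fun x y => by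
    rw [hδ]; split_ifs <;> simp
  -- Polarization: weighting by `i^m` or `(-i)^m` and summing over `m` isolates one cross term. The
  -- factor `|d|` makes up for each matrix unit being recovered with coefficient `8 c²` in total.
  refine ⟨fun a x => c * (δ x a.1.1 + Complex.I ^ (a.2 : ℕ) * δ x a.1.2),
    fun a => Matrix.of fun k l => Fintype.card d *
      (Complex.I ^ (a.2 : ℕ) * δ k a.1.2 * δ l a.1.1 +
      (-Complex.I) ^ (a.2 : ℕ) * δ k a.1.1 * δ l a.1.2), ?_, ?_, ?_⟩
  · intro x y
    simp only [Fintype.sum_prod_type, Fin.sum_univ_four]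
    trans ∑ a : d, ∑ b : d, (c : ℂ) * c * 4 * (δ x a * δ y a + δ x b * δ y b)
    · refine Finset.sum_congr rfl fun a _ => Finset.sum_congr rfl fun b _ => ?_
      simp [hs, pow_succ]
      ring_nf
      simp only [Complex.I_sq]
      ring
    · simp only [mul_add, Finset.sum_add_distrib, ← Finset.mul_sum, Finset.sum_const,
        Finset.card_univ, hδ]
      by_cases hxy : x = y
      · simp [hxy]
        linear_combination hc
      · simp [hxy]
  · intro a
    ext k l
    simp [Matrix.conjTranspose_apply, hs]
    ring
  · intro x y k l
    simp only [Fintype.sum_prod_type, Fin.sum_univ_four]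
    trans ∑ a : d, ∑ b : d, (c : ℂ) * c * (4 * Fintype.card d) *
      (δ x b * δ y a * δ k b * δ l a + δ x a * δ y b * δ k a * δ l b)
    · refine Finset.sum_congr rfl fun a _ => Finset.sum_congr rfl fun b _ => ?_
      simp [hs, pow_succ]
      ring_nf
      simp only [Complex.I_sq]
      ring
    · by_cases hk : k = x
      · by_cases hl : l = y
        · subst hk hl
          simp [mul_add, Finset.sum_add_distrib, hδ]
          linear_combination hc
        · simp [hk, hl, mul_add, Finset.sum_add_distrib, Ne.symm hl, hδ]
      · simp [hk, mul_add, Finset.sum_add_distrib, Ne.symm hk, hδ]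

end Tomography

/-! ### Moments of the empirical state. -/

section Empirical

/-- The estimate of the state from the outcomes `α`: the mean of the matrices `D (α t)`. -/
noncomputable def empiricalMean {d A : Type*} (D : A → Matrix d d ℂ) {N : ℕ} (α : Fin N → A) : Matrix d d ℂ :=
  ∑ t, ((N : ℂ)⁻¹) • D (α t)

theorem prod_empiricalMean {d A : Type*} (D : A → Matrix d d ℂ) {n N : ℕ} (α : Fin N → A) (i j : Fin n → d) :
    ∏ t, empiricalMean D α (i t) (j t) =
      ((N : ℂ) ^ n)⁻¹ * ∑ s : Fin n → Fin N, ∏ t, D (α (s t)) (i t) (j t) := by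
  simp only [empiricalMean, Matrix.sum_apply, Matrix.smul_apply, smul_eq_mul, ← Finset.mul_sum,
    Finset.prod_mul_distrib, Finset.prod_const, Finset.card_univ, Fintype.card_fin,
    Finset.prod_univ_sum, Fintype.piFinset_univ, inv_pow]

variable {d A : Type*} [Fintype d] [DecidableEq d] [Fintype A]

theorem Exchangeable.apply_comp_perm {ρ : (n : ℕ) → DensityMatrix (Fin n → d)}
    (hρ : Exchangeable ρ) {n : ℕ} (σ : Equiv.Perm (Fin n)) (i j : Fin n → d) :
    (ρ n).1 (i ∘ σ) (j ∘ σ) = (ρ n).1 i j :=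
  apply_comp_perm_of_permOp σ (hρ.symmetric n σ) i j

/-- The outcome weights of product measurements are consistent. -/
theorem Exchangeable.sum_productWeight_mul_castAdd {ρ : (n : ℕ) → DensityMatrix (Fin n → d)}
    (hρ : Exchangeable ρ) {v : A → d → ℂ} (hv : IsResolution v) {n : ℕ} (m : ℕ)
    (f : (Fin n → A) → ℂ) :
    ∑ α, productWeight v (ρ (n + m)).1 α * f (α ∘ Fin.castAdd m) =
      ∑ α, productWeight v (ρ n).1 α * f α := by
  induction m with
  | zero => rfl
  | succ m ih =>
    rw [← ih]
    refine (sum_fin_succ_snoc (n := n + m) _).trans ?_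
    refine Finset.sum_congr rfl fun α _ => ?_
    have h : ∀ a : A, (Fin.snoc (α := fun _ => A) α a) ∘ Fin.castAdd (m + 1) =
        α ∘ Fin.castAdd m := fun a => by
      ext t
      exact Fin.snoc_castSucc (α := fun _ => A) a α (Fin.castAdd m t)
    simp only [h, ← Finset.sum_mul]
    rw [sum_productWeight_snoc hv, hρ.extendible (n + m)]
    rfl

theorem Exchangeable.sum_productWeight_mul_comp {ρ : (n : ℕ) → DensityMatrix (Fin n → d)}
    (hρ : Exchangeable ρ) {v : A → d → ℂ} (hv : IsResolution v) {n N : ℕ}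
    {s : Fin n → Fin N} (hs : Function.Injective s) (f : (Fin n → A) → ℂ) :
    ∑ α, productWeight v (ρ N).1 α * f (α ∘ s) = ∑ α, productWeight v (ρ n).1 α * f α := by
  obtain ⟨m, rfl⟩ : ∃ m, N = n + m := Nat.exists_eq_add_of_le (by
    simpa using Fintype.card_le_of_injective s hs)
  -- A permutation moving the first `n` trials to the positions `s` reduces the claim to the
  -- marginal on an initial block.
  obtain ⟨σ, hσ⟩ := Equiv.Perm.exists_extending_pair (Fin.castAdd m) s
    (Fin.castAdd_injective n m) hs
  rw [← hρ.sum_productWeight_mul_castAdd hv m f]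
  refine Fintype.sum_equiv (σ.arrowCongr (Equiv.refl A)).symm _ _ fun α => ?_
  have e : (σ.arrowCongr (Equiv.refl A)).symm α = α ∘ σ := by ext; simp [Equiv.arrowCongr]
  rw [e, productWeight_comp_perm v σ (hρ.apply_comp_perm σ)]
  congr 2
  ext t
  simp [hσ]

theorem norm_sum_productWeight_mul_le {v : A → d → ℂ} (hv : IsResolution v) {n : ℕ}
    (R : DensityMatrix (Fin n → d)) {f : (Fin n → A) → ℂ} {C : ℝ} (hf : ∀ α, ‖f α‖ ≤ C) :
    ‖∑ α, productWeight v R.1 α * f α‖ ≤ C := by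
  have h1 : ∑ α, ‖productWeight v R.1 α‖ = 1 := by
    have h := sum_productWeight hv R.1
    rw [R.2.2] at h
    have h2 : ∀ α, productWeight v R.1 α = (‖productWeight v R.1 α‖ : ℂ) := fun α =>
      Complex.eq_coe_norm_of_nonneg (productWeight_nonneg v R.2.1 α)
    rw [Finset.sum_congr rfl fun α _ => h2 α] at h
    exact_mod_cast h
  calc ‖∑ α, productWeight v R.1 α * f α‖ ≤ ∑ α, ‖productWeight v R.1 α‖ * C := by
        refine (norm_sum_le _ _).trans (Finset.sum_le_sum fun α _ => ?_)
        rw [norm_mul]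
        exact mul_le_mul_of_nonneg_left (hf α) (norm_nonneg _)
    _ = C := by rw [← Finset.sum_mul, h1, one_mul]

/-- Up to an error from repeated trials, the moments of the estimate are the entries of `ρ n`. -/
theorem Exchangeable.norm_moment_sub_le {ρ : (n : ℕ) → DensityMatrix (Fin n → d)}
    (hρ : Exchangeable ρ) {v : A → d → ℂ} (hv : IsResolution v) {D : A → Matrix d d ℂ}
    (hD : ∀ x y k l, ∑ a, star (v a x) * v a y * D a k l = if k = x ∧ l = y then 1 else 0)
    {C : ℝ} (hC : ∀ a k l, ‖D a k l‖ ≤ C) {n N : ℕ} (hN : 0 < N) (i j : Fin n → d) :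
    ‖∑ α, productWeight v (ρ N).1 α * ∏ t, empiricalMean D α (i t) (j t) - (ρ n).1 i j‖ ≤
      (1 - (N.descFactorial n : ℝ) / N ^ n) * (C ^ n + ‖(ρ n).1 i j‖) := by
  classical
  set T : (Fin n → Fin N) → ℂ := fun s =>
    ∑ α, productWeight v (ρ N).1 α * ∏ t, D (α (s t)) (i t) (j t)
  have hT : ∀ s, ‖T s‖ ≤ C ^ n := fun s => by
    refine norm_sum_productWeight_mul_le hv _ fun α => ?_
    rw [norm_prod]
    refine (Finset.prod_le_prod (fun _ _ => norm_nonneg _) fun t _ => hC _ _ _).trans ?_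
    simp
  -- For distinct trials the marginal is `ρ n`, and the inversion formula `hD`, applied in each
  -- factor, returns its entry exactly.
  have hTi : ∀ s, Function.Injective s → T s = (ρ n).1 i j := fun s hs => by
    have h := hρ.sum_productWeight_mul_comp hv hs (fun β => ∏ t, D (β t) (i t) (j t))
    simp only [Function.comp] at h
    simp only [T, h]
    rw [sum_productWeight_mul_prod v (ρ n).1 (fun t a => D a (i t) (j t))]
    simp only [hD]
    rw [Finset.sum_eq_single i, Finset.sum_eq_single j]
    · simp
    · intro j' _ hj
      obtain ⟨t, ht⟩ := Function.ne_iff.1 hj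
      rw [Finset.prod_eq_zero (Finset.mem_univ t), mul_zero]
      simp [Ne.symm ht]
    · simp
    · intro i' _ hi
      obtain ⟨t, ht⟩ := Function.ne_iff.1 hi
      refine Finset.sum_eq_zero fun j' _ => ?_
      rw [Finset.prod_eq_zero (Finset.mem_univ t), mul_zero]
      simp [Ne.symm ht]
    · simp
  have hNn : (0 : ℝ) < (N : ℝ) ^ n := by positivity
  have hNn' : ((N : ℂ) ^ n) ≠ 0 := by
    have := hN.ne'
    positivity
  -- Only selections with a repeated trial contribute to the error; there are `N ^ n -
  -- N.descFactorial n` of them.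
  have hmain : ∑ α, productWeight v (ρ N).1 α * ∏ t, empiricalMean D α (i t) (j t) - (ρ n).1 i j
      = ((N : ℂ) ^ n)⁻¹ * ∑ s with ¬ Function.Injective s, (T s - (ρ n).1 i j) := by
    have h1 : ∑ s with ¬ Function.Injective s, (T s - (ρ n).1 i j) = ∑ s, (T s - (ρ n).1 i j) := by
      refine Finset.sum_subset (Finset.subset_univ _) fun s _ hs => ?_
      simp only [Finset.mem_filter, Finset.mem_univ, true_and, not_not] at hs
      rw [hTi s hs, sub_self]
    rw [h1, Finset.sum_sub_distrib]
    simp only [prod_empiricalMean, T]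
    rw [Finset.sum_comm]
    simp only [Finset.sum_const, Finset.card_univ, Fintype.card_fun, Fintype.card_fin,
      nsmul_eq_mul, Nat.cast_pow, mul_sub, inv_mul_cancel_left₀ hNn', ← Finset.mul_sum]
    rw [Finset.mul_sum]
    congr 1
    exact Finset.sum_congr rfl fun _ _ => by ring
  have hcard : ((Finset.univ.filter fun s : Fin n → Fin N => ¬ Function.Injective s).card : ℝ) =
      N ^ n - N.descFactorial n := by
    have h1 := Finset.card_filter_add_card_filter_not (s := Finset.univ)
      (fun s : Fin n → Fin N => Function.Injective s)
    have h2 : (Finset.univ.filter fun s : Fin n → Fin N => Function.Injective s).card =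
        N.descFactorial n := by
      rw [← Fintype.card_subtype, Fintype.card_congr (Equiv.subtypeInjectiveEquivEmbedding _ _),
        Fintype.card_embedding_eq, Fintype.card_fin, Fintype.card_fin]
    rw [h2, Finset.card_univ, Fintype.card_fun, Fintype.card_fin, Fintype.card_fin] at h1
    rw [eq_sub_iff_add_eq, add_comm]
    exact_mod_cast h1
  rw [hmain, norm_mul, norm_inv, norm_pow, Complex.norm_natCast]
  calc ((N : ℝ) ^ n)⁻¹ * ‖∑ s with ¬ Function.Injective s, (T s - (ρ n).1 i j)‖
      ≤ ((N : ℝ) ^ n)⁻¹ * ((N ^ n - N.descFactorial n) * (C ^ n + ‖(ρ n).1 i j‖)) := by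
        refine mul_le_mul_of_nonneg_left ?_ (by positivity)
        rw [← hcard, ← nsmul_eq_mul]
        refine (norm_sum_le _ _).trans (Finset.sum_le_card_nsmul _ _ _ fun s _ => ?_)
        exact (norm_sub_le _ _).trans (add_le_add_left (hT s) _)
    _ = _ := by field_simp

theorem tendsto_descFactorial_div_pow (n : ℕ) :
    Filter.Tendsto (fun N : ℕ => (N.descFactorial n : ℝ) / N ^ n) Filter.atTop (nhds 1) := by
  induction n with
  | zero => simp
  | succ n ih =>
    have h : Filter.Tendsto (fun N : ℕ => 1 - (n : ℝ) / N) Filter.atTop (nhds (1 - 0)) :=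
      tendsto_const_nhds.sub (tendsto_const_div_atTop_nhds_zero_nat _)
    have h2 := h.mul ih
    rw [sub_zero, one_mul] at h2
    refine h2.congr' ?_
    filter_upwards [Filter.eventually_ge_atTop n, Filter.eventually_gt_atTop 0] with N hN hN0
    rw [Nat.descFactorial_succ, Nat.cast_mul, Nat.cast_sub hN, pow_succ]
    field_simp

theorem Exchangeable.tendsto_moment {ρ : (n : ℕ) → DensityMatrix (Fin n → d)}
    (hρ : Exchangeable ρ) {v : A → d → ℂ} (hv : IsResolution v) {D : A → Matrix d d ℂ}
    (hD : ∀ x y k l, ∑ a, star (v a x) * v a y * D a k l = if k = x ∧ l = y then 1 else 0)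
    {C : ℝ} (hC : ∀ a k l, ‖D a k l‖ ≤ C) {n : ℕ} (i j : Fin n → d) :
    Filter.Tendsto (fun N => ∑ α, productWeight v (ρ N).1 α *
      ∏ t, empiricalMean D α (i t) (j t)) Filter.atTop (nhds ((ρ n).1 i j)) := by
  rw [tendsto_iff_norm_sub_tendsto_zero]
  have h := ((tendsto_const_nhds (x := (1 : ℝ))).sub (tendsto_descFactorial_div_pow n)).mul_const
    (C ^ n + ‖(ρ n).1 i j‖)
  rw [sub_self, zero_mul] at h
  refine squeeze_zero' (Filter.Eventually.of_forall fun _ => norm_nonneg _) ?_ h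
  filter_upwards [Filter.eventually_gt_atTop 0] with N hN
  exact hρ.norm_moment_sub_le hv hD hC hN i j

end Empirical

/-! ### Moment conditions and the support of a measure. -/

section Support

variable {X : Type*} [TopologicalSpace X] [CompactSpace X] [MeasurableSpace X] [BorelSpace X]

theorem Continuous.integrable_of_compactSpace {E : Type*} [NormedAddCommGroup E]
    {f : X → E} (hf : Continuous f) (P : Measure X)
    [IsFiniteMeasure P] : Integrable f P :=
  hf.integrable_of_hasCompactSupport (HasCompactSupport.of_compactSpace f)

/-- A nonnegative continuous function with integral zero vanishes on the support. -/
theorem eq_zero_of_mem_support_of_integral_eq_zero (P : Measure X) [IsFiniteMeasure P]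
    {f : X → ℝ} (hf : Continuous f) (h0 : ∀ x, 0 ≤ f x) (h : ∫ x, f x ∂P = 0) {x : X}
    (hx : x ∈ P.support) : f x = 0 := by
  rw [integral_eq_zero_iff_of_nonneg h0 (hf.integrable_of_compactSpace P)] at h
  exact Measure.support_subset_of_isClosed (isClosed_eq hf continuous_const) h hx

/-- If the even moments of a continuous function stay bounded by one, then the function is bounded
by one on the support. -/
theorem abs_le_one_of_mem_support (P : Measure X) [IsFiniteMeasure P]
    {f : X → ℝ} (hf : Continuous f) (h : ∀ n : ℕ, ∫ x, f x ^ (2 * n) ∂P ≤ 1) {x : X}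
    (hx : x ∈ P.support) : |f x| ≤ 1 := by
  by_contra! hlt
  obtain ⟨c, hc1, hc⟩ := exists_between hlt
  have hU : 0 < P {y | c < |f y|} := by
    rw [Measure.mem_support_iff_forall] at hx
    exact hx _ ((isOpen_lt continuous_const hf.abs).mem_nhds hc)
  have hU' : 0 < P.real {y | c < |f y|} := ENNReal.toReal_pos hU.ne' (measure_ne_top _ _)
  -- Markov's inequality for `f ^ (2 * n)`; since `c > 1`, it cannot hold for all `n` on a set of
  -- positive mass.
  have hb : ∀ n : ℕ, (c ^ 2) ^ n * P.real {y | c < |f y|} ≤ 1 := fun n => by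
    refine le_trans ?_ (h n)
    refine le_trans ?_ (mul_meas_ge_le_integral_of_nonneg
      (Filter.Eventually.of_forall fun y => (even_two_mul n).pow_nonneg (f y))
      ((hf.pow (2 * n)).integrable_of_compactSpace P) ((c ^ 2) ^ n))
    refine mul_le_mul_of_nonneg_left (measureReal_mono fun y hy => ?_) (by positivity)
    simp only [Set.mem_ofPred_eq] at hy ⊢
    rw [← pow_mul, ← (even_two_mul n).pow_abs (f y)]
    exact pow_le_pow_left₀ (by linarith) hy.le _
  have ht : Filter.Tendsto (fun n : ℕ => (c ^ 2) ^ n * P.real {y | c < |f y|}) Filter.atTop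
      Filter.atTop :=
    (tendsto_pow_atTop_atTop_of_one_lt (by nlinarith)).atTop_mul_const hU'
  obtain ⟨n, hn⟩ := (ht.eventually_gt_atTop 1).exists
  exact absurd (hb n) (not_le.2 hn)

end Support

/-! ### A representing measure on Hermitian matrices. -/

section HermBox

/-- The self-adjoint matrices with entries bounded by `C`. -/
def hermBox (d : Type*) (C : ℝ) : Set (Matrix d d ℂ) :=
  {M | M.IsHermitian ∧ ∀ i j, ‖M i j‖ ≤ C}

noncomputable instance (d : Type*) (C : ℝ) : MeasurableSpace (hermBox d C) := borel _

instance (d : Type*) (C : ℝ) : BorelSpace (hermBox d C) := ⟨rfl⟩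

theorem isCompact_hermBox (d : Type*) [Finite d] (C : ℝ) : IsCompact (hermBox d C) := by
  have hK : IsCompact (Set.univ.pi fun _ : d => Set.univ.pi fun _ : d =>
      Metric.closedBall (0 : ℂ) C) :=
    isCompact_univ_pi fun _ => isCompact_univ_pi fun _ => isCompact_closedBall _ _
  refine IsCompact.of_isClosed_subset (X := Matrix d d ℂ) hK ?_ fun M hM => ?_
  · have h1 : IsClosed {M : Matrix d d ℂ | M.IsHermitian} :=
      isClosed_eq continuous_id.matrix_conjTranspose continuous_id
    have h2 : IsClosed {M : Matrix d d ℂ | ∀ i j, ‖M i j‖ ≤ C} := by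
      simp only [Set.ofPred_forall]
      exact isClosed_iInter fun i => isClosed_iInter fun j =>
        isClosed_le (continuous_id.matrix_elem i j).norm continuous_const
    exact h1.inter h2
  · exact fun i _ j _ => mem_closedBall_zero_iff.2 (hM.2 i j)

instance (d : Type*) [Finite d] (C : ℝ) : CompactSpace (hermBox d C) :=
  isCompact_iff_compactSpace.1 (isCompact_hermBox d C)

theorem empiricalMean_mem_hermBox {d A : Type*} {D : A → Matrix d d ℂ}
    (hD : ∀ a, (D a).IsHermitian) {C : ℝ} (hC0 : 0 ≤ C) (hC : ∀ a k l, ‖D a k l‖ ≤ C) {N : ℕ}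
    (α : Fin N → A) : empiricalMean D α ∈ hermBox d C := by
  refine ⟨?_, fun i j => ?_⟩
  · rw [Matrix.IsHermitian, empiricalMean, Matrix.conjTranspose_sum]
    refine Finset.sum_congr rfl fun t _ => ?_
    rw [Matrix.conjTranspose_smul, (hD _).eq]
    simp
  · simp only [empiricalMean, Matrix.sum_apply, Matrix.smul_apply, smul_eq_mul, ← Finset.mul_sum]
    rw [norm_mul, norm_inv, Complex.norm_natCast]
    -- For `N = 0` the mean is the zero matrix, whence the assumption `0 ≤ C`.
    rcases N.eq_zero_or_pos with rfl | hN
    · simpa using hC0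
    · rw [inv_mul_le_iff₀ (by positivity)]
      refine (norm_sum_le _ _).trans ((Finset.sum_le_card_nsmul _ _ _ fun t _ => hC _ _ _).trans ?_)
      simp

variable {d : Type*} [Fintype d] [DecidableEq d]

theorem continuous_tensorPow_apply {d : Type*} (n : ℕ) (i j : Fin n → d) :
    Continuous fun M : Matrix d d ℂ => tensorPow n M i j :=
  continuous_finsetProd Finset.univ fun t _ => continuous_id.matrix_elem (i t) (j t)

/-- The law of the empirical mean of the outcomes of the product measurement. -/
theorem exists_measure_empiricalMean {A : Type*} [Fintype A] {v : A → d → ℂ} (hv : IsResolution v)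
    {D : A → Matrix d d ℂ} {C : ℝ} {N : ℕ} (R : DensityMatrix (Fin N → d))
    (hx : ∀ α : Fin N → A, empiricalMean D α ∈ hermBox d C) :
    ∃ P : ProbabilityMeasure (hermBox d C), ∀ f : Matrix d d ℂ → ℂ, Continuous f →
      ∫ s, f s.1 ∂(P : Measure (hermBox d C)) =
        ∑ α, productWeight v R.1 α * f (empiricalMean D α) := by
  have hw : ∀ α, productWeight v R.1 α = (‖productWeight v R.1 α‖ : ℂ) := fun α =>
    Complex.eq_coe_norm_of_nonneg (productWeight_nonneg v R.2.1 α)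
  have h1 : ∑ α, ‖productWeight v R.1 α‖ = 1 := by
    have h := sum_productWeight hv R.1
    rw [R.2.2, Finset.sum_congr rfl fun α _ => hw α] at h
    exact_mod_cast h
  let P : Measure (hermBox d C) := ∑ α, ENNReal.ofReal ‖productWeight v R.1 α‖ •
    Measure.dirac ⟨empiricalMean D α, hx α⟩
  have hP : IsProbabilityMeasure P := ⟨by
    simp only [P, Measure.finsetSum_apply, Measure.smul_apply, measure_univ, smul_eq_mul, mul_one]
    rw [← ENNReal.ofReal_sum_of_nonneg fun _ _ => norm_nonneg _, h1, ENNReal.ofReal_one]⟩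
  refine ⟨⟨P, hP⟩, fun f hf => ?_⟩
  have hf' : Continuous fun s : hermBox d C => f s.1 := hf.comp continuous_subtype_val
  simp only [ProbabilityMeasure.coe_mk, P]
  rw [integral_finsetSum_measure fun α _ => ?_]
  · refine Finset.sum_congr rfl fun α _ => ?_
    rw [integral_smul_measure, integral_dirac' _ _ hf'.stronglyMeasurable,
      ENNReal.toReal_ofReal (norm_nonneg _), Complex.real_smul, ← hw]
  · exact (hf'.integrable_of_compactSpace _).smul_measure ENNReal.ofReal_ne_top

/-- An exchangeable sequence is represented by a measure on self-adjoint matrices. -/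
theorem Exchangeable.exists_hermBox_representation [Nonempty d]
    {ρ : (n : ℕ) → DensityMatrix (Fin n → d)} (hρ : Exchangeable ρ) :
    ∃ (C : ℝ) (P : ProbabilityMeasure (hermBox d C)), ∀ (n : ℕ) (i j : Fin n → d),
      (ρ n).1 i j = ∫ s, tensorPow n s.1 i j ∂(P : Measure (hermBox d C)) := by
  obtain ⟨v, D, hv, hDh, hD⟩ := exists_tomography d
  obtain ⟨C, hC0, hC⟩ : ∃ C : ℝ, 0 ≤ C ∧ ∀ a k l, ‖D a k l‖ ≤ C := by
    refine ⟨∑ a, ∑ k, ∑ l, ‖D a k l‖, by positivity, fun a k l => ?_⟩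
    refine le_trans ?_ (Finset.single_le_sum (f := fun a => ∑ k, ∑ l, ‖D a k l‖)
      (fun _ _ => by positivity) (Finset.mem_univ a))
    refine le_trans ?_ (Finset.single_le_sum (f := fun k => ∑ l, ‖D a k l‖)
      (fun _ _ => by positivity) (Finset.mem_univ k))
    exact Finset.single_le_sum (f := fun l => ‖D a k l‖)
      (fun _ _ => norm_nonneg _) (Finset.mem_univ l)
  choose P hP using fun N => exists_measure_empiricalMean hv (C := C) (ρ N)
    (fun α => empiricalMean_mem_hermBox hDh hC0 hC α)
  -- Probability measures on the compact box form a compact space; an ultrafilter limit replaces the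
  -- choice of a subsequence.
  obtain ⟨Q, -, hQ⟩ := isCompact_univ.ultrafilter_le_nhds ((Filter.hyperfilter ℕ).map P) (by simp)
  refine ⟨C, Q, fun n i j => ?_⟩
  have hc : Continuous fun s : hermBox d C => tensorPow n s.1 i j :=
    (continuous_tensorPow_apply n i j).comp continuous_subtype_val
  have hQ' : Filter.Tendsto P (Filter.hyperfilter ℕ) (nhds Q) := hQ
  rw [ProbabilityMeasure.tendsto_iff_forall_integral_rclike_tendsto ℂ] at hQ'
  have h1 := hQ' (BoundedContinuousFunction.mkOfCompact ⟨_, hc⟩)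
  simp only [BoundedContinuousFunction.mkOfCompact_apply, ContinuousMap.coe_mk,
    hP _ _ (continuous_tensorPow_apply n i j)] at h1
  refine tendsto_nhds_unique ?_ h1
  exact (hρ.tendsto_moment hv hD hC i j).mono_left
    (by simpa [Nat.cofinite_eq_atTop] using Filter.hyperfilter_le_cofinite (α := ℕ))

end HermBox

/-! ### The representing measure is carried by states. -/

section States

theorem Matrix.IsHermitian.trace_eq_re {d : Type*} [Fintype d] {M : Matrix d d ℂ}
    (hM : M.IsHermitian) : M.trace = (M.trace.re : ℂ) := by
  refine (Complex.conj_eq_iff_re.1 ?_).symm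
  rw [starRingEnd_apply, ← Matrix.trace_conjTranspose, hM.eq]

theorem Matrix.IsHermitian.star_dotProduct_mulVec_eq_re {d : Type*} [Fintype d]
    {M : Matrix d d ℂ} (hM : M.IsHermitian) (ψ : d → ℂ) :
    star ψ ⬝ᵥ M.mulVec ψ = ((star ψ ⬝ᵥ M.mulVec ψ).re : ℂ) := by
  refine (Complex.conj_eq_iff_re.1 ?_).symm
  rw [starRingEnd_apply, ← Matrix.star_dotProduct, Matrix.star_mulVec, hM.eq,
    ← Matrix.dotProduct_mulVec]

/-- The moments of a linear function of a matrix with the moments `R`. -/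
theorem integral_linear_pow {d : Type*} [Fintype d] {C : ℝ} (P : Measure (hermBox d C)) [IsFiniteMeasure P] {n : ℕ}
    {R : Matrix (Fin n → d) (Fin n → d) ℂ} (hR : ∀ i j, R i j = ∫ s, tensorPow n s.1 i j ∂P)
    (G : d → d → ℂ) :
    ∫ s, (∑ x, ∑ y, s.1 x y * G x y) ^ n ∂P = ∑ i, ∑ j, R i j * ∏ t, G (i t) (j t) := by
  have h : ∀ M : Matrix d d ℂ, (∑ x, ∑ y, M x y * G x y) ^ n =
      ∑ i : Fin n → d, ∑ j : Fin n → d, tensorPow n M i j * ∏ t, G (i t) (j t) := fun M => by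
    have h1 : (∑ x, ∑ y, M x y * G x y) ^ n = ∏ _t : Fin n, ∑ x, ∑ y, M x y * G x y := by simp
    simp only [h1, Finset.prod_univ_sum, Fintype.piFinset_univ, tensorPow, Matrix.of_apply,
      Finset.prod_mul_distrib]
  have hc : ∀ i j, Integrable (fun s : hermBox d C =>
      tensorPow n s.1 i j * ∏ t, G (i t) (j t)) P := fun i j =>
    (((continuous_tensorPow_apply n i j).comp continuous_subtype_val).mul
      continuous_const).integrable_of_compactSpace P
  simp only [h]
  rw [integral_finsetSum _ fun i _ => integrable_finsetSum _ fun j _ => hc i j]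
  refine Finset.sum_congr rfl fun i _ => ?_
  rw [integral_finsetSum _ fun j _ => hc i j]
  refine Finset.sum_congr rfl fun j _ => ?_
  rw [integral_mul_const, hR]

variable {d : Type*} [Fintype d] [DecidableEq d]

/-- A vector of norm at most one is part of a resolution of the identity. -/
theorem exists_resolution_extending {ψ : d → ℂ} (hψ : ∑ x, ‖ψ x‖ ^ 2 ≤ 1) :
    ∃ (m : ℕ) (v : Option (Fin m) → d → ℂ), IsResolution v ∧ v none = ψ := by
  -- Positivity is Cauchy–Schwarz; a rank one decomposition of this complement supplies the
  -- remaining vectors, conjugated to match the convention of `IsResolution`.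
  have hpsd : (1 - Matrix.vecMulVec (star ψ) ψ : Matrix d d ℂ).PosSemidef := by
    refine .of_dotProduct_mulVec_nonneg ?_ fun x => ?_
    · ext i j
      simp [Matrix.conjTranspose_apply, Matrix.vecMulVec_apply, Matrix.one_apply, mul_comm,
        eq_comm, apply_ite (starRingEnd ℂ)]
    · have h1 : star x ⬝ᵥ (1 - Matrix.vecMulVec (star ψ) ψ).mulVec x =
          ((∑ i, ‖x i‖ ^ 2 - ‖∑ i, ψ i * x i‖ ^ 2 : ℝ) : ℂ) := by
        rw [Matrix.sub_mulVec, Matrix.one_mulVec, dotProduct_sub, Matrix.vecMulVec_mulVec]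
        push_cast
        rw [← Complex.conj_mul' (∑ i, ψ i * x i)]
        congr 1
        · exact Finset.sum_congr rfl fun i _ => Complex.conj_mul' (x i)
        · simp [dotProduct, Finset.sum_mul, Finset.mul_sum, mul_comm, mul_left_comm]
      rw [h1, Complex.zero_le_real, sub_nonneg]
      calc ‖∑ i, ψ i * x i‖ ^ 2 ≤ (∑ i, ‖ψ i‖ * ‖x i‖) ^ 2 := by
            refine pow_le_pow_left₀ (norm_nonneg _) ((norm_sum_le _ _).trans ?_) 2
            simp
        _ ≤ (∑ i, ‖ψ i‖ ^ 2) * ∑ i, ‖x i‖ ^ 2 := Finset.sum_mul_sq_le_sq_mul_sq _ _ _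
        _ ≤ 1 * ∑ i, ‖x i‖ ^ 2 := mul_le_mul_of_nonneg_right hψ (by positivity)
        _ = _ := one_mul _
  obtain ⟨m, w, hw⟩ := Matrix.posSemidef_iff_eq_sum_vecMulVec.1 hpsd
  refine ⟨m, fun a => a.elim ψ fun k => star (w k), fun x y => ?_, rfl⟩
  have h := congrFun (congrFun hw x) y
  simp only [Matrix.sub_apply, Matrix.one_apply, Matrix.vecMulVec_apply, Matrix.sum_apply] at h
  rw [Fintype.sum_option]
  simp only [Option.elim, Pi.star_apply, star_star] at h ⊢
  rw [← h]
  ring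

variable {ρ : (n : ℕ) → DensityMatrix (Fin n → d)} {C : ℝ}
  {P : Measure (hermBox d C)} [IsProbabilityMeasure P]

/-- Every moment of the trace is `tr (ρ n) = 1`, so the trace has mean square distance zero from 1.
-/
theorem trace_eq_one_of_mem_support
    (hP : ∀ (n : ℕ) (i j : Fin n → d), (ρ n).1 i j = ∫ s, tensorPow n s.1 i j ∂P)
    {s : hermBox d C} (hs : s ∈ P.support) : s.1.trace = 1 := by
  have hreal : ∀ s : hermBox d C, s.1.trace = (s.1.trace.re : ℂ) := fun s => s.2.1.trace_eq_re
  have hc : Continuous fun s : hermBox d C => s.1.trace.re :=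
    Complex.continuous_re.comp continuous_subtype_val.matrix_trace
  have hmom : ∀ n : ℕ, ∫ s, s.1.trace.re ^ n ∂P = 1 := fun n => by
    have h := integral_linear_pow P (hP n) (fun x y => if x = y then 1 else 0)
    have h1 : ∑ i, ∑ j, (ρ n).1 i j * ∏ t, (if i t = j t then (1 : ℂ) else 0) = 1 := by
      refine Eq.trans ?_ (ρ n).2.2
      rw [Matrix.trace]
      refine Finset.sum_congr rfl fun i _ => ?_
      simp [Finset.prod_ite_zero, ← funext_iff]
    rw [h1] at h
    have h2 : ∀ s : hermBox d C, (∑ x, ∑ y, s.1 x y * (if x = y then (1 : ℂ) else 0)) ^ n =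
        ((s.1.trace.re ^ n : ℝ) : ℂ) := fun s => by
      rw [Complex.ofReal_pow, ← hreal]
      simp [Matrix.trace]
    simp only [h2] at h
    rw [integral_complex_ofReal] at h
    exact_mod_cast h
  have hsq : ∫ s, (s.1.trace.re - 1) ^ 2 ∂P = 0 := by
    have e : ∀ s : hermBox d C, (s.1.trace.re - 1) ^ 2 =
        s.1.trace.re ^ 2 - 2 * s.1.trace.re ^ 1 + 1 := fun s => by ring
    simp only [e]
    have hi : ∀ n : ℕ, Integrable (fun s : hermBox d C => s.1.trace.re ^ n) P := fun n =>
      (hc.pow n).integrable_of_compactSpace P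
    have hi2 : Integrable (fun s : hermBox d C => s.1.trace.re ^ 2 - 2 * s.1.trace.re ^ 1) P :=
      (hi 2).sub ((hi 1).const_mul 2)
    rw [integral_add hi2 (integrable_const _),
      integral_sub (hi 2) ((hi 1).const_mul 2), integral_const_mul, hmom, hmom]
    simp
    norm_num
  have h0 : (s.1.trace.re - 1) ^ 2 = 0 := eq_zero_of_mem_support_of_integral_eq_zero P
    ((hc.sub continuous_const).pow 2) (fun s => sq_nonneg _) hsq hs
  rw [hreal, sub_eq_zero.1 (pow_eq_zero_iff two_ne_zero |>.1 h0), Complex.ofReal_one]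

/-- Complete `ψ` to a resolution. The moments of `tr s - ⟨ψ|s|ψ⟩` are the probabilities that no
trial has outcome `ψ`, hence at most 1. -/
theorem re_dotProduct_mulVec_nonneg_of_mem_support
    (hP : ∀ (n : ℕ) (i j : Fin n → d), (ρ n).1 i j = ∫ s, tensorPow n s.1 i j ∂P)
    {s : hermBox d C} (hs : s ∈ P.support) {ψ : d → ℂ} (hψ : ∑ x, ‖ψ x‖ ^ 2 ≤ 1) :
    0 ≤ (star ψ ⬝ᵥ s.1.mulVec ψ).re := by
  obtain ⟨m, v, hv, hv0⟩ := exists_resolution_extending hψ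
  let g : Option (Fin m) → ℂ := fun a => a.elim 0 fun _ => 1
  let G : d → d → ℂ := fun x y => ∑ a, star (v a x) * v a y * g a
  have hG : ∀ x y, G x y = (if x = y then 1 else 0) - star (ψ x) * ψ y := fun x y => by
    rw [← hv x y, ← hv0]
    simp [G, g, Fintype.sum_option]
  have hval : ∀ s : hermBox d C, ∑ x, ∑ y, s.1 x y * G x y =
      s.1.trace - star ψ ⬝ᵥ s.1.mulVec ψ := fun s => by
    simp only [hG, mul_sub, Finset.sum_sub_distrib]
    congr 1
    · simp [Matrix.trace]
    · simp only [dotProduct, Matrix.mulVec, Finset.mul_sum, Pi.star_apply]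
      exact Finset.sum_congr rfl fun x _ => Finset.sum_congr rfl fun y _ => by ring
  have hreal : ∀ s : hermBox d C, s.1.trace - star ψ ⬝ᵥ s.1.mulVec ψ =
      ((s.1.trace - star ψ ⬝ᵥ s.1.mulVec ψ).re : ℂ) := fun s => by
    rw [Complex.sub_re, Complex.ofReal_sub, ← s.2.1.trace_eq_re,
      ← s.2.1.star_dotProduct_mulVec_eq_re]
  have hc : Continuous fun s : hermBox d C => (s.1.trace - star ψ ⬝ᵥ s.1.mulVec ψ).re := by
    refine Complex.continuous_re.comp ?_
    exact continuous_subtype_val.matrix_trace.sub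
      (continuous_const.dotProduct (continuous_subtype_val.matrix_mulVec continuous_const))
  have hb : ∀ n : ℕ, ∫ s, (s.1.trace - star ψ ⬝ᵥ s.1.mulVec ψ).re ^ (2 * n) ∂P ≤ 1 := fun n => by
    have h := integral_linear_pow P (hP (2 * n)) G
    rw [← sum_productWeight_mul_prod v (ρ (2 * n)).1 (fun _ => g)] at h
    simp only [hval] at h
    have h1 : ‖∑ α, productWeight v (ρ (2 * n)).1 α * ∏ t, g (α t)‖ ≤ 1 := by
      refine norm_sum_productWeight_mul_le hv _ fun α => ?_
      rw [norm_prod]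
      refine Finset.prod_le_one (fun _ _ => norm_nonneg _) fun t _ => ?_
      cases α t <;> simp [g]
    rw [← h] at h1
    have h2 : ∀ s : hermBox d C, (s.1.trace - star ψ ⬝ᵥ s.1.mulVec ψ) ^ (2 * n) =
        (((s.1.trace - star ψ ⬝ᵥ s.1.mulVec ψ).re ^ (2 * n) : ℝ) : ℂ) := fun s => by
      rw [Complex.ofReal_pow, ← hreal]
    simp only [h2] at h1
    rw [integral_complex_ofReal] at h1
    exact (le_abs_self _).trans (by simpa using h1)
  have h := abs_le_one_of_mem_support P hc hb hs
  rw [trace_eq_one_of_mem_support hP hs, Complex.sub_re, Complex.one_re] at h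
  linarith [(abs_le.1 h).2]

theorem posSemidef_of_mem_support
    (hP : ∀ (n : ℕ) (i j : Fin n → d), (ρ n).1 i j = ∫ s, tensorPow n s.1 i j ∂P)
    {s : hermBox d C} (hs : s ∈ P.support) : s.1.PosSemidef := by
  refine .of_dotProduct_mulVec_nonneg s.2.1 fun x => ?_
  rw [s.2.1.star_dotProduct_mulVec_eq_re, Complex.zero_le_real]
  -- Since `r ≥ 1`, `‖x‖² ≤ r ≤ r²`, so `x / r` lies in the unit ball; this needs neither a square
  -- root nor `x ≠ 0`.
  set r : ℝ := 1 + ∑ i, ‖x i‖ ^ 2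
  have hr : 1 ≤ r := le_add_of_nonneg_right (by positivity)
  have hr0 : (0 : ℝ) < r := by linarith
  have h := re_dotProduct_mulVec_nonneg_of_mem_support hP hs (ψ := (r⁻¹ : ℝ) • x) (by
    simp only [Pi.smul_apply, norm_smul, mul_pow, ← Finset.mul_sum, Real.norm_eq_abs, sq_abs]
    rw [inv_pow, inv_mul_le_iff₀ (by positivity)]
    have : ∑ i, ‖x i‖ ^ 2 ≤ r := le_add_of_nonneg_left zero_le_one
    nlinarith)
  rw [star_smul, Matrix.mulVec_smul, smul_dotProduct, dotProduct_smul, Complex.smul_re,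
    Complex.smul_re, star_trivial, smul_eq_mul, smul_eq_mul, ← mul_assoc] at h
  exact nonneg_of_mul_nonneg_right h (by positivity)

end States

/-! ### Compactness of the space of states. -/

theorem Matrix.PosSemidef.norm_apply_le_re_trace {d : Type*} [Fintype d] {M : Matrix d d ℂ}
    (hM : M.PosSemidef) (i j : d) : ‖M i j‖ ≤ M.trace.re := by
  obtain ⟨m, w, rfl⟩ := Matrix.posSemidef_iff_eq_sum_vecMulVec.1 hM
  have hd : (Matrix.trace (∑ k, Matrix.vecMulVec (w k) (star (w k)))).re =
      ∑ k, ∑ x, ‖w k x‖ ^ 2 := by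
    rw [Matrix.trace_sum, Complex.re_sum]
    refine Finset.sum_congr rfl fun k _ => ?_
    simp only [Matrix.trace, Matrix.diag_apply, Matrix.vecMulVec_apply, Pi.star_apply,
      Complex.re_sum]
    refine Finset.sum_congr rfl fun x _ => ?_
    rw [← starRingEnd_apply, Complex.mul_conj']
    norm_cast
  rw [hd, Matrix.sum_apply]
  refine (norm_sum_le _ _).trans (Finset.sum_le_sum fun k _ => ?_)
  rw [Matrix.vecMulVec_apply, Pi.star_apply, norm_mul, norm_star]
  have hle : ∀ x, ‖w k x‖ ^ 2 ≤ ∑ x, ‖w k x‖ ^ 2 := fun x =>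
    Finset.single_le_sum (f := fun x => ‖w k x‖ ^ 2) (fun _ _ => by positivity)
      (Finset.mem_univ x)
  nlinarith [hle i, hle j, sq_nonneg (‖w k i‖ - ‖w k j‖)]

namespace DensityMatrix

theorem isCompact_setOf {d : Type*} [Fintype d] : IsCompact {M : Matrix d d ℂ | M.PosSemidef ∧ M.trace = 1} := by
  refine (isCompact_hermBox d 1).of_isClosed_subset ?_ fun M hM => ⟨hM.1.isHermitian, fun i j => ?_⟩
  · have h1 : IsClosed {M : Matrix d d ℂ | M.PosSemidef} := by
      simp only [Matrix.posSemidef_iff_dotProduct_mulVec, Set.ofPred_and, Set.ofPred_forall]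
      refine IsClosed.inter (isClosed_eq continuous_id.matrix_conjTranspose continuous_id) ?_
      exact isClosed_iInter fun x => isClosed_le continuous_const
        (continuous_const.dotProduct (continuous_id.matrix_mulVec continuous_const))
    exact h1.inter (isClosed_eq continuous_id.matrix_trace continuous_const)
  · have h := hM.1.norm_apply_le_re_trace i j
    rwa [hM.2, Complex.one_re] at h

variable {d : Type*} [Fintype d] [DecidableEq d]

theorem isClosedEmbedding_val :
    Topology.IsClosedEmbedding fun s : DensityMatrix d => s.1 :=
  isCompact_setOf.isClosed.isClosedEmbedding_subtypeVal

theorem continuous_val : Continuous fun s : DensityMatrix d => s.1 :=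
  isClosedEmbedding_val.continuous

instance : CompactSpace (DensityMatrix d) := isCompact_iff_compactSpace.1 isCompact_setOf

instance : PolishSpace (DensityMatrix d) :=
  have : PolishSpace (Matrix d d ℂ) := inferInstanceAs (PolishSpace (d → d → ℂ))
  isClosedEmbedding_val.polishSpace

end DensityMatrix

/-! ### Existence and uniqueness of the representing measure. -/

section Representation

variable {d : Type*} [Fintype d] [DecidableEq d]

/-- The quantum de Finetti theorem: existence of the representing measure. -/
theorem Exchangeable.exists_representation {ρ : (n : ℕ) → DensityMatrix (Fin n → d)}
    (hρ : Exchangeable ρ) :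
    ∃ P : ProbabilityMeasure (DensityMatrix d), IsDeFinettiRepresentation ρ P := by
  have : Nonempty d := by
    by_contra h
    rw [not_nonempty_iff] at h
    have h1 := (ρ 1).2.2
    simp [Matrix.trace] at h1
  obtain ⟨C, Q, hQ⟩ := hρ.exists_hermBox_representation
  have : SecondCountableTopology (Matrix d d ℂ) :=
    inferInstanceAs (SecondCountableTopology (d → d → ℂ))
  let : MeasurableSpace (Matrix d d ℂ) := borel _
  have : BorelSpace (Matrix d d ℂ) := ⟨rfl⟩
  have hval : Measurable fun s : hermBox d C => s.1 := continuous_subtype_val.measurable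
  have hemb := (DensityMatrix.isClosedEmbedding_val (d := d)).measurableEmbedding
  -- The measure passes to states through the space of all matrices: push forward from the box, then
  -- pull back along the closed embedding of the states.
  let ν : Measure (Matrix d d ℂ) := (Q : Measure (hermBox d C)).map fun s => s.1
  have hae : ∀ᵐ M ∂ν, M ∈ Set.range fun s : DensityMatrix d => s.1 := by
    refine (ae_map_iff hval.aemeasurable hemb.measurableSet_range).2 ?_
    filter_upwards [Measure.support_mem_ae (μ := (Q : Measure (hermBox d C)))] with s hs
    exact ⟨⟨s.1, posSemidef_of_mem_support hQ hs, trace_eq_one_of_mem_support hQ hs⟩, rfl⟩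
  have hmap : (ν.comap fun s : DensityMatrix d => s.1).map (fun s => s.1) = ν := by
    rw [hemb.map_comap, Measure.restrict_eq_self_of_ae_mem hae]
  have hprob : IsProbabilityMeasure (ν.comap fun s : DensityMatrix d => s.1) := by
    have : IsProbabilityMeasure ν := Measure.isProbabilityMeasure_map hval.aemeasurable
    constructor
    rw [← Set.preimage_univ (f := fun s : DensityMatrix d => s.1),
      ← hemb.map_apply, hmap, measure_univ]
  refine ⟨⟨_, hprob⟩, fun n i j => ?_⟩
  have hc := continuous_tensorPow_apply (d := d) n i j
  rw [hQ, ProbabilityMeasure.coe_mk, ← hemb.integral_map (fun M => tensorPow n M i j), hmap,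
    integral_map hval.aemeasurable hc.aestronglyMeasurable]

theorem DensityMatrix.integrable_tensorPow (P : Measure (DensityMatrix d)) [IsFiniteMeasure P]
    (n : ℕ) (i j : Fin n → d) : Integrable (fun s : DensityMatrix d => tensorPow n s.1 i j) P :=
  ((continuous_tensorPow_apply n i j).comp DensityMatrix.continuous_val).integrable_of_compactSpace P

/-- The entries of a state as bounded continuous functions. -/
noncomputable def DensityMatrix.entry (x y : d) :
    BoundedContinuousFunction (DensityMatrix d) ℂ :=
  BoundedContinuousFunction.mkOfCompact ⟨fun s => s.1 x y, continuous_val.matrix_elem x y⟩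

/-- Products of entries are entries of tensor powers. -/
theorem DensityMatrix.exists_eq_tensorPow_of_mem_closure
    {f : BoundedContinuousFunction (DensityMatrix d) ℂ}
    (hf : f ∈ Submonoid.closure (Set.range fun p : d × d => entry p.1 p.2)) :
    ∃ (n : ℕ) (i j : Fin n → d), ∀ s, f s = tensorPow n s.1 i j := by
  induction hf using Submonoid.closure_induction with
  | mem f hf =>
    obtain ⟨p, rfl⟩ := hf
    exact ⟨1, fun _ => p.1, fun _ => p.2, fun s => by simp [tensorPow, entry]⟩
  | one => exact ⟨0, Fin.elim0, Fin.elim0, fun s => by simp [tensorPow]⟩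
  | mul f g _ _ hf hg =>
    obtain ⟨n, i, j, hf⟩ := hf
    obtain ⟨m, k, l, hg⟩ := hg
    refine ⟨n + m, Fin.append i k, Fin.append j l, fun s => ?_⟩
    simp [hf, hg, tensorPow, Fin.prod_univ_add]

/-- The star algebra generated by the entries is spanned by products of entries. -/
theorem DensityMatrix.mem_span_of_mem_adjoin_entry
    {f : BoundedContinuousFunction (DensityMatrix d) ℂ}
    (hf : f ∈ StarAlgebra.adjoin ℂ (Set.range fun p : d × d => entry p.1 p.2)) :
    f ∈ Submodule.span ℂ (Submonoid.closure (Set.range fun p : d × d => entry p.1 p.2) :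
      Set (BoundedContinuousFunction (DensityMatrix d) ℂ)) := by
  have hstar : star (Set.range fun p : d × d => entry p.1 p.2) ⊆
      Set.range fun p : d × d => entry p.1 p.2 := by
    rintro g ⟨⟨x, y⟩, hg⟩
    refine ⟨(y, x), ?_⟩
    rw [← star_star g, ← hg]
    ext s
    exact (s.2.1.isHermitian.apply y x).symm
  rwa [← StarSubalgebra.mem_toSubalgebra, StarAlgebra.adjoin_toSubalgebra,
    Set.union_eq_self_of_subset_right hstar, ← Subalgebra.mem_toSubmodule,
    Algebra.adjoin_eq_span] at hf

/-- The entries separate states and the star algebra they generate is spanned by entries of tensor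
powers, whose integrals are prescribed by `ρ`. -/
theorem IsDeFinettiRepresentation.unique {ρ : (n : ℕ) → DensityMatrix (Fin n → d)}
    {P P' : ProbabilityMeasure (DensityMatrix d)} (hP : IsDeFinettiRepresentation ρ P)
    (hP' : IsDeFinettiRepresentation ρ P') : P' = P := by
  refine Subtype.ext (ext_of_forall_mem_subalgebra_integral_eq_of_polish (𝕜 := ℂ)
    (P := (P' : Measure (DensityMatrix d))) (P' := (P : Measure (DensityMatrix d)))
    (A := StarAlgebra.adjoin ℂ (Set.range fun p : d × d => DensityMatrix.entry p.1 p.2)) ?_ ?_)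
  · intro s t hst
    obtain ⟨x, y, hxy⟩ : ∃ x y, s.1 x y ≠ t.1 x y := by
      by_contra! h
      exact hst (Subtype.ext (Matrix.ext h))
    exact ⟨_, ⟨_, ⟨DensityMatrix.entry x y, StarAlgebra.subset_adjoin ℂ _ ⟨(x, y), rfl⟩, rfl⟩,
      rfl⟩, hxy⟩
  · intro g hg
    have hg' := DensityMatrix.mem_span_of_mem_adjoin_entry hg
    clear hg
    induction hg' using Submodule.span_induction with
    | mem f hf =>
      obtain ⟨n, i, j, h⟩ := DensityMatrix.exists_eq_tensorPow_of_mem_closure hf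
      simp only [h]
      exact (hP' n i j).symm.trans (hP n i j)
    | zero => simp
    | add f g _ _ hf hg =>
      simp only [BoundedContinuousFunction.add_apply]
      rw [integral_add (f.integrable _) (g.integrable _),
        integral_add (f.integrable _) (g.integrable _), hf, hg]
    | smul c f _ hf =>
      simp only [BoundedContinuousFunction.smul_apply, integral_smul, hf]

end Representation

/-! ### From two-trial constraints to single-trial constraints. -/

section Constraints

variable {d : Type*} [Fintype d] [DecidableEq d]

theorem tensorSq_hermTensor_tmul {V : Type*} [AddCommGroup V] [Module ℝ V] (L : Herm d →ₗ[ℝ] V)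
    (A B : Herm d) : tensorSq L (hermTensor (A ⊗ₜ[ℝ] B)) = L A ⊗ₜ[ℝ] L B := by
  have h : hermTensorEquiv.symm (hermTensor (A ⊗ₜ[ℝ] B)) = A ⊗ₜ[ℝ] B :=
    hermTensorEquiv.symm_apply_apply _
  simp [tensorSq, h]

/-- Extending `l` to all matrices along `realPart` lets it act entrywise, which gives continuity and
commutation with entrywise integrals. -/
theorem exists_eq_sum_apply_entry {ι : Type*} [Fintype ι] [DecidableEq ι] (l : Herm ι →ₗ[ℝ] ℝ) :
    ∃ e : ι → ι → ℂ →L[ℝ] ℝ, ∀ A : Herm ι, l A = ∑ i, ∑ j, e i j (A.1 i j) := by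
  refine ⟨fun i j => LinearMap.toContinuousLinearMap
    ((l ∘ₗ realPart) ∘ₗ Matrix.singleLinearMap ℝ i j), fun A => ?_⟩
  have hA : realPart A.1 = A := A.2.coe_realPart |> Subtype.ext
  conv_lhs => rw [← hA, Matrix.matrix_eq_sum_single A.1]
  simp [map_sum]

theorem hermTensor_toHerm_tmul_self (s : DensityMatrix d) :
    (hermTensor (s.toHerm ⊗ₜ[ℝ] s.toHerm)).1 = tensorPow 2 s.1 := by
  rw [hermTensor_tmul]
  ext i j
  simp [prodOp, tensorPow, DensityMatrix.toHerm]

theorem continuous_apply_hermTensor (l : Herm (Fin 2 → d) →ₗ[ℝ] ℝ) :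
    Continuous fun s : DensityMatrix d => l (hermTensor (s.toHerm ⊗ₜ[ℝ] s.toHerm)) := by
  obtain ⟨e, he⟩ := exists_eq_sum_apply_entry l
  simp only [he, hermTensor_toHerm_tmul_self]
  exact continuous_finsetSum _ fun i _ => continuous_finsetSum _ fun j _ => (e i j).continuous.comp
    ((continuous_tensorPow_apply 2 i j).comp DensityMatrix.continuous_val)

/-- A real-linear functional of the two-trial state is the average of its values on product
states. -/
theorem IsDeFinettiRepresentation.apply_two_eq_integral
    {ρ : (n : ℕ) → DensityMatrix (Fin n → d)} {P : ProbabilityMeasure (DensityMatrix d)}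
    (hP : IsDeFinettiRepresentation ρ P) (l : Herm (Fin 2 → d) →ₗ[ℝ] ℝ) :
    l (ρ 2).toHerm = ∫ s, l (hermTensor (s.toHerm ⊗ₜ[ℝ] s.toHerm))
      ∂(P : Measure (DensityMatrix d)) := by
  obtain ⟨e, he⟩ := exists_eq_sum_apply_entry l
  have hi : ∀ i j, Integrable (fun s : DensityMatrix d => e i j (tensorPow 2 s.1 i j))
      (P : Measure (DensityMatrix d)) := fun i j =>
    (e i j).integrable_comp (DensityMatrix.integrable_tensorPow _ 2 i j)
  simp only [he, hermTensor_toHerm_tmul_self]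
  rw [integral_finsetSum _ fun i _ => integrable_finsetSum _ fun j _ => hi i j]
  refine Finset.sum_congr rfl fun i _ => ?_
  rw [integral_finsetSum _ fun j _ => hi i j]
  refine Finset.sum_congr rfl fun j _ => ?_
  rw [(e i j).integral_comp_comm (DensityMatrix.integrable_tensorPow _ 2 i j), ← hP 2 i j]
  rfl

theorem Module.Basis.toDual_self {ι V : Type*} [DecidableEq ι] [AddCommGroup V]
    [Module ℝ V] (b : Module.Basis ι ℝ V) (v : V) :
    b.toDual v v = ∑ i ∈ (b.repr v).support, b.repr v i ^ 2 := by
  have h : b.toDual v (Finsupp.linearCombination ℝ b (b.repr v)) =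
      ∑ i ∈ (b.repr v).support, b.repr v i ^ 2 := by
    rw [Finsupp.linearCombination_apply, Finsupp.sum, map_sum]
    refine Finset.sum_congr rfl fun i _ => ?_
    rw [map_smul, b.toDual_apply_left, smul_eq_mul, sq]
  rwa [b.linearCombination_repr] at h

/-- A linear functional on `V ⊗ V` that is a positive definite quadratic form on `V`. -/
theorem exists_posDef_functional (V : Type*) [AddCommGroup V] [Module ℝ V] :
    ∃ φ : V ⊗[ℝ] V →ₗ[ℝ] ℝ, (∀ v, 0 ≤ φ (v ⊗ₜ v)) ∧ ∀ v, φ (v ⊗ₜ v) = 0 → v = 0 := by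
  classical
  -- With a Hamel basis every vector has finitely many nonzero coordinates, so the sum of their
  -- squares makes sense in any dimension.
  let b := Module.Basis.ofVectorSpace ℝ V
  refine ⟨TensorProduct.lift b.toDual, fun v => ?_, fun v hv => ?_⟩
  · rw [TensorProduct.lift.tmul, b.toDual_self]
    positivity
  · rw [TensorProduct.lift.tmul, b.toDual_self,
      Finset.sum_eq_zero_iff_of_nonneg fun _ _ => sq_nonneg _] at hv
    refine b.repr.map_eq_zero_iff.1 (Finsupp.ext fun i => ?_)
    by_contra h
    exact h (pow_eq_zero_iff two_ne_zero |>.1 (hv i (Finsupp.mem_support_iff.2 h)))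

/-- The exceptional set of `y` is fixed by `ρ 2` alone. For each other `y`, a continuous nonnegative
function of `s` has integral zero and so vanishes on the whole support; no joint measurability in
`(s, y)` is needed. -/
theorem IsDeFinettiRepresentation.ae_apply_eq_zero
    {ρ : (n : ℕ) → DensityMatrix (Fin n → d)} {P : ProbabilityMeasure (DensityMatrix d)}
    (hP : IsDeFinettiRepresentation ρ P) {Y : Type*} [MeasurableSpace Y] {μ : Measure Y}
    {V : Type*} [AddCommGroup V] [Module ℝ V] {L : Y → (Herm d →ₗ[ℝ] V)} {q : Y → ℝ}
    (hq : ∀ᵐ y ∂μ, 0 < q y)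
    (hL : IntegralEqZero μ fun y => q y • tensorSq (L y) (ρ 2).toHerm)
    {s : DensityMatrix d} (hs : s ∈ (P : Measure (DensityMatrix d)).support) :
    ∀ᵐ y ∂μ, L y s.toHerm = 0 := by
  obtain ⟨φ, hφ0, hφ⟩ := exists_posDef_functional V
  have hmean : ∀ y, φ (tensorSq (L y) (ρ 2).toHerm) =
      ∫ s, φ (L y s.toHerm ⊗ₜ L y s.toHerm) ∂(P : Measure (DensityMatrix d)) := fun y => by
    have h := hP.apply_two_eq_integral (φ ∘ₗ tensorSq (L y))
    simpa only [LinearMap.comp_apply, tensorSq_hermTensor_tmul] using h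
  have hnonneg : ∀ y, 0 ≤ φ (tensorSq (L y) (ρ 2).toHerm) := fun y => by
    rw [hmean]
    exact integral_nonneg fun s => hφ0 _
  obtain ⟨hi, h0⟩ := hL φ
  simp only [map_smul, smul_eq_mul] at hi h0
  rw [integral_eq_zero_iff_of_nonneg_ae
    (hq.mono fun y hy => mul_nonneg hy.le (hnonneg y)) hi] at h0
  filter_upwards [hq, h0] with y hy hy0
  have hzero : φ (tensorSq (L y) (ρ 2).toHerm) = 0 :=
    (mul_eq_zero.1 hy0).resolve_left hy.ne'
  rw [hmean] at hzero
  have hc := continuous_apply_hermTensor (φ ∘ₗ tensorSq (L y))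
  simp only [LinearMap.comp_apply, tensorSq_hermTensor_tmul] at hc
  exact hφ _ (eq_zero_of_mem_support_of_integral_eq_zero _ hc (fun s => hφ0 _) hzero hs)

end Constraints

theorem theorem2
    {d : Type*} [Fintype d] [DecidableEq d]
    {Y : Type*} [MeasurableSpace Y] (μ : Measure Y)
    {K : Type*} (V : K → Type*) [∀ k, AddCommGroup (V k)] [∀ k, Module ℝ (V k)]
    (L : (k : K) → Y → (Herm d →ₗ[ℝ] V k))
    (q : K → Y → ℝ) (hq : ∀ k, ∀ᵐ y ∂μ, 0 < q k y)
    (ρ : (n : ℕ) → DensityMatrix (Fin n → d)) (hρ : Exchangeable ρ)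
    (hconstr : ∀ k, IntegralEqZero μ (fun y => q k y • tensorSq (L k y) (ρ 2).toHerm)) :
    ∃ P : ProbabilityMeasure (DensityMatrix d),
      IsDeFinettiRepresentation ρ P ∧
      (∀ᵐ s ∂(P : Measure (DensityMatrix d)), ∀ k, ∀ᵐ y ∂μ, L k y s.toHerm = 0) ∧
      ∀ P' : ProbabilityMeasure (DensityMatrix d), IsDeFinettiRepresentation ρ P' → P' = P := by
  obtain ⟨P, hP⟩ := hρ.exists_representation
  refine ⟨P, hP, ?_, fun P' hP' => hP.unique hP'⟩
  -- The support has full measure and does not depend on `k`, so the index set may be uncountable.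
  filter_upwards [Measure.support_mem_ae (μ := (P : Measure (DensityMatrix d)))] with s hs k
  exact hP.ae_apply_eq_zero (hq k) (hconstr k) hs
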